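/- Let $\mathbb{T}=\mathbb{R}/\mathbb{Z}$ be the circle with normalized Lebesgue measure $|\cdot|$. For a finite positive Borel measure $\nu$ on $\mathbb{T}$ let \[ \omega_\nu(t):=\sup\{|\nu(I)-\nu(J)| \,:\, I,J \text{ adjacent arcs of } \mathbb{T},\ |I|=|J|\le t\},\qquad \hat\nu(n):=\int_{\mathbb{T}}e^{-2\pi i n x}\,d\nu(x)\quad (n\in\mathbb{Z}). \] For a function $\varphi:(0,1]\to(0,\infty)$, the measure $\nu$ is called $\varphi$-smooth if there is a constant $C>0$ such that $\omega_\nu(\delta)\le C\,\delta\,\varphi(\delta)$ for all $\delta\in(0,1]$. Let $p\ge 2$ be a real number, let $\varphi:(0,1]\to(0,\infty)$ satisfy $\int_0^1\frac{\varphi(t)^p}{t}\,dt<\infty$, and let $\nu$ be a finite positive Borel measure on $\mathbb{T}$ that is $\varphi$-smooth and singular with respect to Lebesgue measure. Then \[ \sum_{n\in\mathbb{Z}}|\hat\nu(n)|^p<\infty . \] -/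

import Mathlib

open MeasureTheory Set
open scoped ENNReal

noncomputable section

/-- The half-open arc `[a, a + h)` of the circle `ℝ / ℤ`, for real `a` and `h`. When `0 < h ≤ 1`
its normalized length is `h`. -/
def circleArc (a h : ℝ) : Set UnitAddCircle :=
  (fun x : ℝ => (x : UnitAddCircle)) '' Ico a (a + h)

/-- The modulus of smoothness of a (finite, positive) Borel measure `ν` on the circle `ℝ / ℤ`:
`ω_ν(t) = sup |ν(I) - ν(J)|`, the supremum being over all pairs of adjacent arcs `I`, `J` of the
same normalized length `h ≤ t`. Two adjacent (hence disjoint) arcs of length `h` exist on the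
circle exactly when `2 * h ≤ 1`. -/
def modulusOfSmoothness (ν : Measure UnitAddCircle) (t : ℝ) : ℝ :=
  sSup {d : ℝ | ∃ a h : ℝ, 0 < h ∧ h ≤ t ∧ 2 * h ≤ 1 ∧
    d = |ν.real (circleArc a h) - ν.real (circleArc (a + h) h)|}

/-- `ν` is `φ`-smooth, for `φ : (0, 1] → (0, ∞)`: there is `C > 0` such that
`ω_ν(δ) ≤ C δ φ(δ)` for all `δ ∈ (0, 1]`. Only the values of `φ` on `(0, 1]` matter. -/
def IsSmoothMeasure (φ : ℝ → ℝ) (ν : Measure UnitAddCircle) : Prop :=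
  ∃ C : ℝ, 0 < C ∧ ∀ δ ∈ Ioc (0 : ℝ) 1, modulusOfSmoothness ν δ ≤ C * δ * φ δ

/-- The Fourier coefficient `∫ exp (-2 π i n x) dν(x)` of a measure `ν` on the circle `ℝ / ℤ`. -/
def measureFourierCoeff (ν : Measure UnitAddCircle) (n : ℤ) : ℂ :=
  ∫ x : UnitAddCircle, fourier (-n) x ∂ν

end

/-! The function `F_h(x) = ν[x, x+h) - ν[x+h, x+2h)` is bounded by `ω_ν(h)` and is a convolution of
`ν` with `arcDifference h`. Its `n`-th Fourier coefficient is therefore `ν̂(n)` times a factor of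
modulus `|e(nh) - 1|² / (2π|n|)`, where `e(x) = exp(2πix)`. This factor is at least `2h/π` when `1/4
≤ |n|h ≤ 1/2`. Bessel's inequality then bounds the `ℓ²` norm of `ν̂` on such a block by `(π/2)
ω_ν(h)/h` (`sum_norm_measureFourierCoeff_sq_le`), and for `p ≥ 2` the `ℓ^p` norm is no larger. With
dyadic `h` the blocks exhaust `n ≠ 0`, and the sum of `(ω_ν(h)/h)^p` is dominated by the integral of
`φ^p/t` (`summable_dyadic_of_lintegral`). -/

/-! ### Arcs and the modulus of smoothness -/

theorem measurableSet_circleArc {a h : ℝ} (hh : h ≤ 1) : MeasurableSet (circleArc a h) := by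
  refine measurableSet_Ico.image_of_measurable_injOn AddCircle.measurable_mk' ?_
  have hsub : Ico a (a + h) ⊆ Ico a (a + 1) := Ico_subset_Ico_right (by linarith)
  exact fun x hx y hy hxy => (AddCircle.coe_eq_coe_iff_of_mem_Ico (hsub hx) (hsub hy)).1 hxy

theorem sub_coe_mem_circleArc_iff (a h b : ℝ) (y : UnitAddCircle) :
    y - (b : UnitAddCircle) ∈ circleArc a h ↔ y ∈ circleArc (a + b) h := by
  constructor
  · rintro ⟨x, hx, hxy⟩
    exact ⟨x + b, ⟨by linarith [hx.1], by linarith [hx.2]⟩, by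
      simp only [AddCircle.coe_add]
      rw [eq_sub_iff_add_eq] at hxy
      exact hxy⟩
  · rintro ⟨x, hx, rfl⟩
    exact ⟨x - b, ⟨by linarith [hx.1], by linarith [hx.2]⟩, by simp⟩

theorem coe_mem_circleArc_zero_iff {h x : ℝ} (hh : h ≤ 1 / 2) (hx : x ∈ Ioc (-(1 / 2) : ℝ) (1 / 2)) :
    (x : UnitAddCircle) ∈ circleArc 0 h ↔ x ∈ Ico 0 h := by
  constructor
  · rintro ⟨y, hy, hxy⟩
    simp only [zero_add, mem_Ico] at hy
    have hy' : y ∈ Ioc (-(1 / 2) : ℝ) (-(1 / 2) + 1) := ⟨by linarith [hy.1], by linarith [hy.2]⟩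
    have hx' : x ∈ Ioc (-(1 / 2) : ℝ) (-(1 / 2) + 1) := ⟨hx.1, by linarith [hx.2]⟩
    exact (AddCircle.coe_eq_coe_iff_of_mem_Ioc hy' hx').1 hxy ▸ hy
  · intro h0
    exact ⟨x, by simpa using h0, rfl⟩

/-- The difference of the indicators of two adjacent arcs of length `h`. -/
noncomputable def arcDifference (h : ℝ) (z : UnitAddCircle) : ℂ :=
  (circleArc 0 h).indicator 1 z - (circleArc 0 h).indicator 1 (z - (h : UnitAddCircle))

theorem measurable_arcDifference {h : ℝ} (hh : h ≤ 1) : Measurable (arcDifference h) := by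
  have : Measurable ((circleArc 0 h).indicator (1 : UnitAddCircle → ℂ)) :=
    measurable_one.indicator (measurableSet_circleArc hh)
  exact this.sub (this.comp (measurable_id.sub_const _))

theorem norm_arcDifference_le (h : ℝ) (z : UnitAddCircle) : ‖arcDifference h z‖ ≤ 2 := by
  have key : ∀ w, ‖(circleArc 0 h).indicator (1 : UnitAddCircle → ℂ) w‖ ≤ 1 := fun w => by
    by_cases hw : w ∈ circleArc 0 h <;> simp [hw]
  exact (norm_sub_le _ _).trans (by linarith [key z, key (z - h)])

theorem integral_arcDifference (ν : Measure UnitAddCircle) [IsFiniteMeasure ν] {h : ℝ} (hh : h ≤ 1)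
    (a : ℝ) : ∫ y, arcDifference h (y - (a : UnitAddCircle)) ∂ν =
      ((ν.real (circleArc a h) - ν.real (circleArc (a + h) h) : ℝ) : ℂ) := by
  have key : ∀ y : UnitAddCircle, arcDifference h (y - (a : UnitAddCircle)) =
      (circleArc a h).indicator 1 y - (circleArc (a + h) h).indicator 1 y := fun y => by
    have shift : ∀ b : ℝ, (circleArc 0 h).indicator (1 : UnitAddCircle → ℂ)
        (y - (b : UnitAddCircle)) = (circleArc b h).indicator 1 y := fun b => by
      have h1 := sub_coe_mem_circleArc_iff 0 h b y
      rw [zero_add] at h1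
      by_cases hy : y ∈ circleArc b h
      · rw [indicator_of_mem hy, indicator_of_mem (h1.2 hy)]; rfl
      · rw [indicator_of_notMem hy, indicator_of_notMem (mt h1.1 hy)]
    rw [← shift, ← shift, AddCircle.coe_add, ← sub_sub]
    rfl
  have int : ∀ b : ℝ, Integrable ((circleArc b h).indicator (1 : UnitAddCircle → ℂ)) ν := fun b =>
    (integrable_const (1 : ℂ)).indicator (measurableSet_circleArc hh)
  have val : ∀ b : ℝ, ∫ y, (circleArc b h).indicator (1 : UnitAddCircle → ℂ) y ∂ν =
      (ν.real (circleArc b h) : ℂ) := fun b => by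
    have := integral_indicator_const (μ := ν) (1 : ℂ) (measurableSet_circleArc (a := b) hh)
    rwa [Complex.real_smul, mul_one] at this
  simp_rw [key]
  rw [integral_sub (int _) (int _), val, val, Complex.ofReal_sub]

theorem abs_sub_le_modulusOfSmoothness (ν : Measure UnitAddCircle) [IsFiniteMeasure ν]
    {h t : ℝ} (h0 : 0 < h) (hht : h ≤ t) (hh : 2 * h ≤ 1) (a : ℝ) :
    |ν.real (circleArc a h) - ν.real (circleArc (a + h) h)| ≤ modulusOfSmoothness ν t := by
  refine le_csSup ⟨ν.real univ, ?_⟩ ⟨a, h, h0, hht, hh, rfl⟩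
  rintro d ⟨b, k, -, -, -, rfl⟩
  have hle : ∀ s, ν.real s ≤ ν.real univ := fun s => measureReal_mono (subset_univ s)
  exact abs_sub_le_of_nonneg_of_le measureReal_nonneg (hle _) measureReal_nonneg (hle _)

theorem modulusOfSmoothness_nonneg (ν : Measure UnitAddCircle) (t : ℝ) :
    0 ≤ modulusOfSmoothness ν t := by
  refine Real.sSup_nonneg ?_
  rintro d ⟨b, k, -, -, -, rfl⟩
  exact abs_nonneg _

theorem modulusOfSmoothness_mono (ν : Measure UnitAddCircle) [IsFiniteMeasure ν] :
    Monotone (modulusOfSmoothness ν) := by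
  intro s t hst
  refine Real.sSup_le ?_ (modulusOfSmoothness_nonneg ν t)
  rintro d ⟨a, h, h0, hs, hh, rfl⟩
  exact abs_sub_le_modulusOfSmoothness ν h0 (hs.trans hst) hh a

/-! ### Fourier coefficients of the convolution -/

theorem norm_fourier_apply (n : ℤ) (x : UnitAddCircle) : ‖fourier n x‖ = 1 :=
  Circle.norm_coe _

theorem fourier_add_apply (n : ℤ) (x y : UnitAddCircle) :
    fourier n (x + y) = fourier n x * fourier n y := by
  simp [fourier_apply, smul_add, AddCircle.toCircle_add]

theorem fourier_mul_fourier_neg (n : ℤ) (x : UnitAddCircle) :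
    fourier n x * fourier (-n) x = 1 := by
  rw [← fourier_add]; simp

/-- Fubini, then the substitution `z = y - x`, which preserves Haar measure. The reflection turns
`n` into `-n` on the kernel. -/
theorem integral_fourier_convolution (ν : Measure UnitAddCircle) [IsFiniteMeasure ν]
    {χ : UnitAddCircle → ℂ} (hχ : Measurable χ) {M : ℝ} (hM : ∀ z, ‖χ z‖ ≤ M) (n : ℤ) :
    fourierCoeff (fun x => ∫ y, χ (y - x) ∂ν) n =
      measureFourierCoeff ν n * fourierCoeff χ (-n) := by
  have hf : Measurable fun q : UnitAddCircle × UnitAddCircle =>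
      fourier (-n) q.1 • χ (q.2 - q.1) :=
    ((map_continuous (fourier (-n))).measurable.comp measurable_fst).smul
      (hχ.comp (measurable_snd.sub measurable_fst))
  have hint : Integrable (Function.uncurry fun x y : UnitAddCircle =>
      fourier (-n) x • χ (y - x)) (AddCircle.haarAddCircle.prod ν) := by
    refine Integrable.of_bound hf.aestronglyMeasurable M (Filter.Eventually.of_forall fun q => ?_)
    simpa only [Function.uncurry, norm_smul, norm_fourier_apply, one_mul] using hM (q.2 - q.1)
  calc
    fourierCoeff (fun x => ∫ y, χ (y - x) ∂ν) n
        = ∫ x, ∫ y, fourier (-n) x • χ (y - x) ∂ν ∂AddCircle.haarAddCircle := by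
      simp only [fourierCoeff, integral_smul]
    _ = ∫ y, ∫ x, fourier (-n) x • χ (y - x) ∂AddCircle.haarAddCircle ∂ν :=
      integral_integral_swap hint
    _ = ∫ y, fourier (-n) y * fourierCoeff χ (-n) ∂ν := by
      refine integral_congr_ae (Filter.Eventually.of_forall fun y => ?_)
      simp only
      rw [← integral_sub_left_eq_self _ AddCircle.haarAddCircle y, fourierCoeff,
        ← integral_const_mul]
      refine integral_congr_ae (Filter.Eventually.of_forall fun z => ?_)
      have : fourier (-n) (y - z) = fourier (-n) y * fourier n z := by
        have h1 := fourier_add_apply (-n) (y - z) z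
        rw [sub_add_cancel] at h1
        rw [h1, mul_assoc, mul_comm (fourier (-n) z), fourier_mul_fourier_neg, mul_one]
      simp only [this, neg_neg, sub_sub_cancel, smul_eq_mul, mul_assoc]
    _ = measureFourierCoeff ν n * fourierCoeff χ (-n) := integral_mul_const _ _

theorem setIntegral_circleArc_fourier {h : ℝ} (h0 : 0 ≤ h) (hh : h ≤ 1 / 2) {n : ℤ} (hn : n ≠ 0) :
    ∫ z, fourier n z * (circleArc 0 h).indicator 1 z ∂(AddCircle.haarAddCircle (T := 1)) =
      (fourier n (h : UnitAddCircle) - 1) / (2 * Real.pi * Complex.I * n) := by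
  -- On the fundamental domain `(-1/2, 1/2]` the arc `[0, h)` does not wrap around.
  rw [AddCircle.integral_haarAddCircle, ← AddCircle.integral_preimage 1 (-(1 / 2)), inv_one,
    one_smul]
  have e1 : ∫ a in Ioc (-(1 / 2) : ℝ) (-(1 / 2) + 1), fourier n (a : UnitAddCircle) *
        (circleArc 0 h).indicator 1 (a : UnitAddCircle) =
      ∫ a in Ioc (-(1 / 2) : ℝ) (-(1 / 2) + 1),
        (Ico 0 h).indicator (fun a : ℝ => fourier n (a : UnitAddCircle)) a := by
    refine setIntegral_congr_fun measurableSet_Ioc fun a ha => ?_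
    have ha' : a ∈ Ioc (-(1 / 2) : ℝ) (1 / 2) := ⟨ha.1, by linarith [ha.2]⟩
    have := coe_mem_circleArc_zero_iff hh ha'
    by_cases hm : a ∈ Ico 0 h
    · simp [indicator, this, hm]
    · simp only [indicator, this, hm, if_false, mul_zero]
  rw [e1, setIntegral_indicator measurableSet_Ico, inter_eq_right.2, integral_Ico_eq_integral_Ioc,
    ← intervalIntegral.integral_of_le h0]
  · have hne : (2 * Real.pi * Complex.I * n : ℂ) ≠ 0 := by
      simp [Real.pi_ne_zero, hn]
    have hd : ∀ x ∈ uIcc 0 h, HasDerivAt (fun y : ℝ =>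
        fourier n (y : UnitAddCircle) / (2 * Real.pi * Complex.I * n))
        (fourier n (x : UnitAddCircle)) x := fun x _ => by
      refine ((hasDerivAt_fourier 1 n x).div_const (2 * Real.pi * Complex.I * n)).congr_deriv ?_
      rw [Complex.ofReal_one, div_one, mul_div_cancel_left₀ _ hne]
    rw [intervalIntegral.integral_eq_sub_of_hasDerivAt hd]
    · simp [sub_div]
    · refine Continuous.intervalIntegrable ?_ _ _
      exact (map_continuous (fourier n)).comp (AddCircle.continuous_mk' 1)
  · intro x hx
    exact ⟨by linarith [hx.1], by linarith [hx.2]⟩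

/-- Translating the arc by `h` multiplies its coefficient by `e(nh)`, so the difference contributes
a second factor `1 - e(nh)`. -/
theorem fourierCoeff_arcDifference {h : ℝ} (h0 : 0 ≤ h) (hh : h ≤ 1 / 2) {n : ℤ} (hn : n ≠ 0) :
    fourierCoeff (arcDifference h) (-n) =
      -(fourier n (h : UnitAddCircle) - 1) ^ 2 / (2 * Real.pi * Complex.I * n) := by
  have hA : Measurable ((circleArc 0 h).indicator (1 : UnitAddCircle → ℂ)) :=
    measurable_one.indicator (measurableSet_circleArc (by linarith))
  have hf : Measurable (fourier n : UnitAddCircle → ℂ) := (map_continuous (fourier n)).measurable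
  have hb : ∀ w, ‖(circleArc 0 h).indicator (1 : UnitAddCircle → ℂ) w‖ ≤ 1 := fun w => by
    by_cases hw : w ∈ circleArc 0 h <;> simp [hw]
  have key := setIntegral_circleArc_fourier h0 hh hn
  have shift : ∫ z, fourier n z * (circleArc 0 h).indicator 1 (z - (h : UnitAddCircle))
      ∂(AddCircle.haarAddCircle (T := 1)) = fourier n (h : UnitAddCircle) *
        ((fourier n (h : UnitAddCircle) - 1) / (2 * Real.pi * Complex.I * n)) := by
    rw [← integral_add_right_eq_self _ (h : UnitAddCircle), ← key, ← integral_const_mul]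
    refine integral_congr_ae (Filter.Eventually.of_forall fun z => ?_)
    simp only [add_sub_cancel_right, fourier_add_apply]
    ring
  rw [fourierCoeff]
  simp only [neg_neg, smul_eq_mul, arcDifference, mul_sub]
  rw [integral_sub, key, shift]
  · ring
  · refine Integrable.of_bound (hf.mul hA).aestronglyMeasurable 1
      (Filter.Eventually.of_forall fun z => ?_)
    simpa only [Pi.mul_apply, norm_mul, norm_fourier_apply, one_mul] using hb z
  · refine Integrable.of_bound (hf.mul (hA.comp (measurable_id.sub_const _))).aestronglyMeasurable 1
      (Filter.Eventually.of_forall fun z => ?_)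
    simpa only [Pi.mul_apply, norm_mul, norm_fourier_apply, one_mul] using hb (z - h)

/-- Here `|e(nh) - 1|² = 2 - 2 cos(2πnh)`, and the angle has modulus in `[π/2, π]`, where the cosine
is nonpositive. -/
theorem norm_fourier_sub_one_sq_ge {n : ℤ} {h : ℝ} (h0 : 1 / 4 ≤ |(n : ℝ)| * h)
    (h1 : |(n : ℝ)| * h ≤ 1 / 2) : 2 ≤ ‖fourier n (h : UnitAddCircle) - 1‖ ^ 2 := by
  have hcos : Real.cos (2 * Real.pi * (n * h)) ≤ 0 := by
    have hh : 0 < h := by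
      by_contra! hneg
      nlinarith [abs_nonneg (n : ℝ)]
    rw [← Real.cos_abs, abs_mul, abs_mul (n : ℝ), abs_of_pos hh,
      abs_of_pos (show 0 < 2 * Real.pi by positivity)]
    apply Real.cos_nonpos_of_pi_div_two_le_of_le <;> nlinarith [Real.pi_pos]
  have e : fourier n (h : UnitAddCircle) =
      Complex.exp ((2 * Real.pi * (n * h) : ℝ) * Complex.I) := by
    rw [fourier_coe_apply]
    congr 1
    push_cast
    ring
  rw [e, Complex.sq_norm, Complex.normSq_apply]
  simp only [Complex.sub_re, Complex.sub_im, Complex.exp_ofReal_mul_I_re,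
    Complex.exp_ofReal_mul_I_im, Complex.one_re, Complex.one_im]
  nlinarith [Real.sin_sq_add_cos_sq (2 * Real.pi * (n * h))]

/-! ### Bessel's inequality on a frequency block -/

theorem sum_norm_fourierCoeff_sq_le {f : UnitAddCircle → ℂ} (hf : Measurable f) {M : ℝ}
    (hM : ∀ x, ‖f x‖ ≤ M) (s : Finset ℤ) : ∑ n ∈ s, ‖fourierCoeff f n‖ ^ 2 ≤ M ^ 2 := by
  have hL : MemLp f 2 (AddCircle.haarAddCircle (T := 1)) :=
    MemLp.of_bound hf.aestronglyMeasurable M (Filter.Eventually.of_forall hM)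
  have h := hasSum_sq_fourierCoeff hL.toLp
  rw [fourierCoeff_congr_ae hL.coeFn_toLp] at h
  refine (sum_le_hasSum s (fun _ _ => by positivity) h).trans ?_
  have : ∫ t, ‖hL.toLp f t‖ ^ 2 ∂(AddCircle.haarAddCircle (T := 1)) ≤
      ∫ _t, M ^ 2 ∂(AddCircle.haarAddCircle (T := 1)) := by
    refine integral_mono_of_nonneg (Filter.Eventually.of_forall fun _ => by positivity)
      (integrable_const _) ?_
    filter_upwards [hL.coeFn_toLp] with x hx
    rw [hx]
    exact pow_le_pow_left₀ (norm_nonneg _) (hM x) 2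
  simpa using this

theorem norm_measureFourierCoeff_mul_le (ν : Measure UnitAddCircle) [IsFiniteMeasure ν] {h : ℝ}
    (hh : h ≤ 1 / 2) {n : ℤ} (h0 : 1 / 4 ≤ |(n : ℝ)| * h) (h1 : |(n : ℝ)| * h ≤ 1 / 2) :
    ‖measureFourierCoeff ν n‖ * (2 / Real.pi * h) ≤
      ‖fourierCoeff (fun x => ∫ y, arcDifference h (y - x) ∂ν) n‖ := by
  have hpos : 0 < h := by
    by_contra! hneg
    nlinarith [abs_nonneg (n : ℝ)]
  have hn : n ≠ 0 := by
    rintro rfl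
    norm_num at h0
  have hn' : 0 < |(n : ℝ)| := by positivity
  rw [integral_fourier_convolution ν (measurable_arcDifference (by linarith))
    (norm_arcDifference_le h), fourierCoeff_arcDifference hpos.le hh hn, norm_mul]
  refine mul_le_mul_of_nonneg_left ?_ (norm_nonneg _)
  rw [norm_div, norm_neg, norm_pow]
  simp only [norm_mul, Complex.norm_real, Complex.norm_I, Complex.norm_intCast, Complex.norm_ofNat,
    Real.norm_eq_abs, abs_of_pos Real.pi_pos, mul_one]
  rw [le_div_iff₀ (by positivity)]
  refine le_trans ?_ (norm_fourier_sub_one_sq_ge h0 h1)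
  have : 2 / Real.pi * h * (2 * Real.pi * |(n : ℝ)|) = 4 * (|(n : ℝ)| * h) := by
    field_simp
    ring
  linarith

theorem sum_norm_measureFourierCoeff_sq_le (ν : Measure UnitAddCircle) [IsFiniteMeasure ν] {h : ℝ}
    (hpos : 0 < h) (hh : h ≤ 1 / 2) (s : Finset ℤ)
    (hs : ∀ n ∈ s, 1 / 4 ≤ |(n : ℝ)| * h ∧ |(n : ℝ)| * h ≤ 1 / 2) :
    ∑ n ∈ s, ‖measureFourierCoeff ν n‖ ^ 2 ≤
      (Real.pi / 2 * (modulusOfSmoothness ν h / h)) ^ 2 := by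
  have hm : Measurable fun x : UnitAddCircle => ∫ y, arcDifference h (y - x) ∂ν := by
    have : StronglyMeasurable (Function.uncurry fun x y : UnitAddCircle =>
        arcDifference h (y - x)) :=
      ((measurable_arcDifference (by linarith)).comp
        (measurable_snd.sub measurable_fst)).stronglyMeasurable
    exact this.integral_prod_right.measurable
  have hb : ∀ x : UnitAddCircle, ‖∫ y, arcDifference h (y - x) ∂ν‖ ≤ modulusOfSmoothness ν h := by
    intro x
    induction x using QuotientAddGroup.induction_on with
    | H a =>
      have := integral_arcDifference ν (h := h) (by linarith) a
      rw [this, Complex.norm_real, Real.norm_eq_abs]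
      exact abs_sub_le_modulusOfSmoothness ν hpos le_rfl (by linarith) a
  have key := sum_norm_fourierCoeff_sq_le hm hb s
  have h2 : (∑ n ∈ s, ‖measureFourierCoeff ν n‖ ^ 2) * (2 / Real.pi * h) ^ 2 ≤
      modulusOfSmoothness ν h ^ 2 := by
    refine le_trans ?_ key
    rw [Finset.sum_mul]
    refine Finset.sum_le_sum fun n hn => ?_
    rw [← mul_pow]
    exact pow_le_pow_left₀ (by positivity)
      (norm_measureFourierCoeff_mul_le ν hh (hs n hn).1 (hs n hn).2) 2
  rw [← le_div_iff₀ (by positivity), ← div_pow] at h2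
  refine h2.trans_eq ?_
  congr 1
  field_simp

/-! ### Summation over dyadic blocks -/

/-- Each `a i` is at most `M`, so `a i ^ p ≤ a i ^ 2 * M ^ (p - 2)`. -/
theorem sum_rpow_le_of_sum_sq_le {ι : Type*} (s : Finset ι) {a : ι → ℝ} (ha : ∀ i, 0 ≤ a i)
    {M p : ℝ} (hM : 0 ≤ M) (hp : 2 ≤ p) (h : ∑ i ∈ s, a i ^ 2 ≤ M ^ 2) :
    ∑ i ∈ s, a i ^ p ≤ M ^ p := by
  have split : ∀ x : ℝ, 0 ≤ x → x ^ p = x ^ 2 * x ^ (p - 2) := fun x hx => by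
    rw [← Real.rpow_two, ← Real.rpow_add_of_nonneg hx (by norm_num) (by linarith)]
    congr 1
    ring
  calc
    ∑ i ∈ s, a i ^ p ≤ ∑ i ∈ s, a i ^ 2 * M ^ (p - 2) := by
      refine Finset.sum_le_sum fun i hi => ?_
      rw [split _ (ha i)]
      refine mul_le_mul_of_nonneg_left (Real.rpow_le_rpow (ha i) ?_ (by linarith)) (sq_nonneg _)
      refine le_of_sq_le_sq ?_ hM
      exact (Finset.single_le_sum (f := fun i => a i ^ 2) (fun _ _ => sq_nonneg _) hi).trans h
    _ = (∑ i ∈ s, a i ^ 2) * M ^ (p - 2) := (Finset.sum_mul ..).symm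
    _ ≤ M ^ 2 * M ^ (p - 2) := mul_le_mul_of_nonneg_right h (by positivity)
    _ = M ^ p := (split M hM).symm

theorem summable_int_of_dyadic {f : ℤ → ℝ} (hf : 0 ≤ f) {b : ℕ → ℝ} (hb : Summable b)
    (h : ∀ (k : ℕ) (s : Finset ℤ), (∀ n ∈ s, n ≠ 0 ∧ Nat.log 2 n.natAbs = k) →
      ∑ n ∈ s, f n ≤ b k) : Summable f := by
  classical
  have hb0 : ∀ k, 0 ≤ b k := fun k => by simpa using h k ∅ (by simp)
  refine summable_of_sum_le (c := f 0 + ∑' k, b k) hf fun u => ?_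
  -- The frequency `0` is split off: `Nat.log 2 0 = 0` would otherwise put it in block `0`.
  have h1 : ∑ n ∈ u, f n ≤ f 0 + ∑ n ∈ u.erase 0, f n := by
    by_cases h0 : (0 : ℤ) ∈ u
    · rw [Finset.add_sum_erase _ _ h0]
    · rw [Finset.erase_eq_of_notMem h0]
      linarith [hf 0, show (0 : ℤ → ℝ) 0 = 0 from rfl]
  refine h1.trans (add_le_add le_rfl ?_)
  rw [← Finset.sum_fiberwise_of_maps_to
    (t := (u.erase 0).image fun n : ℤ => Nat.log 2 n.natAbs)
    (fun n hn => Finset.mem_image_of_mem _ hn)]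
  refine (Finset.sum_le_sum fun k _ => h k _ fun n hn => ?_).trans
    (hb.sum_le_tsum _ fun k _ => hb0 k)
  simp only [Finset.mem_filter, Finset.mem_erase] at hn
  exact ⟨hn.1.1, hn.2⟩

/-- For `t` in `(h, 2h]`, monotonicity of `ω` (none is assumed of `φ`) gives `ω h ≤ ω t ≤ 2Ch φ(t)`.
Hence `φ^p/t ≥ (ω h / (2Ch))^p / (2h)` on an interval of length `h`, and these intervals are
disjoint for dyadic `h`. -/
theorem summable_dyadic_of_lintegral {ω φ : ℝ → ℝ} {C p : ℝ} (hp : 0 ≤ p) (hω : Monotone ω)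
    (hω0 : ∀ t, 0 ≤ ω t) (hC : 0 < C) (hle : ∀ t ∈ Ioc (0 : ℝ) 1, ω t ≤ C * t * φ t)
    (hint : ∫⁻ t in Ioc (0 : ℝ) 1, ENNReal.ofReal (φ t ^ p / t) < ∞) :
    Summable fun k : ℕ => (ω ((1 / 2) ^ (k + 1)) / (1 / 2) ^ (k + 1)) ^ p := by
  set c : ℕ → ℝ := fun k => (ω ((1 / 2) ^ (k + 1)) / (1 / 2) ^ (k + 1)) ^ p with hc
  have hc0 : ∀ k, 0 ≤ c k := fun k => by
    have := hω0 ((1 / 2) ^ (k + 1))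
    positivity
  let I : ℕ → Set ℝ := fun k => Ioc ((1 / 2) ^ (k + 1)) ((1 / 2) ^ k)
  have hanti : Antitone fun k : ℕ => (1 / 2 : ℝ) ^ k :=
    pow_right_anti₀ (by norm_num) (by norm_num)
  have hdisj : Pairwise (Function.onFun Disjoint I) := hanti.pairwise_disjoint_on_Ioc_succ
  have hsub : (⋃ k, I k) ⊆ Ioc 0 1 := iUnion_subset fun k t ht =>
    ⟨lt_trans (by positivity) ht.1, ht.2.trans (pow_le_one₀ (by norm_num) (by norm_num))⟩
  have hblock : ∀ k, ENNReal.ofReal (c k / (2 * (2 * C) ^ p)) ≤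
      ∫⁻ t in I k, ENNReal.ofReal (φ t ^ p / t) := by
    intro k
    set h : ℝ := (1 / 2) ^ (k + 1) with hh
    have hpos : 0 < h := by positivity
    have hk : (1 / 2 : ℝ) ^ k = 2 * h := by rw [hh, pow_succ]; ring
    have hpt : ∀ t ∈ I k, ENNReal.ofReal (c k / (2 * C) ^ p / (2 * h)) ≤
        ENNReal.ofReal (φ t ^ p / t) := by
      intro t ht
      have ht01 := hsub (mem_iUnion.2 ⟨k, ht⟩)
      have ht2 : t ≤ 2 * h := hk ▸ ht.2
      have h1 : ω h ≤ C * t * φ t := (hω ht.1.le).trans (hle t ht01)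
      have hφ0 : 0 ≤ φ t := by
        have := (hω0 h).trans h1
        exact nonneg_of_mul_nonneg_right this (mul_pos hC ht01.1)
      have h2 : ω h / h / (2 * C) ≤ φ t := by
        rw [div_div, div_le_iff₀ (by positivity)]
        refine h1.trans ?_
        nlinarith [mul_le_mul_of_nonneg_left ht2 (mul_nonneg hC.le hφ0)]
      refine ENNReal.ofReal_le_ofReal ?_
      rw [hc, ← Real.div_rpow (div_nonneg (hω0 h) hpos.le) (by positivity)]
      refine div_le_div₀ (by positivity) ?_ ht01.1 ht2
      exact Real.rpow_le_rpow (div_nonneg (div_nonneg (hω0 h) hpos.le) (by positivity)) h2 hp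
    calc
      ENNReal.ofReal (c k / (2 * (2 * C) ^ p))
          = ∫⁻ _t in I k, ENNReal.ofReal (c k / (2 * C) ^ p / (2 * h)) := by
        rw [setLIntegral_const, Real.volume_Ioc, hk, ← ENNReal.ofReal_mul
          (div_nonneg (div_nonneg (hc0 k) (by positivity)) (by positivity))]
        congr 1
        change _ = c k / (2 * C) ^ p / (2 * h) * (2 * h - h)
        field_simp
        ring
      _ ≤ _ := setLIntegral_mono' measurableSet_Ioc hpt
  have hsum : ∑' k, ENNReal.ofReal (c k / (2 * (2 * C) ^ p)) ≠ ∞ := by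
    refine ne_top_of_le_ne_top hint.ne ((ENNReal.tsum_le_tsum hblock).trans ?_)
    rw [← lintegral_iUnion (fun _ => measurableSet_Ioc) hdisj]
    exact lintegral_mono_set hsub
  have hs := ENNReal.summable_toReal hsum
  simp only [ENNReal.toReal_ofReal (div_nonneg (hc0 _)
    (show (0 : ℝ) ≤ 2 * (2 * C) ^ p by positivity))] at hs
  exact (summable_div_const_iff (show (2 * (2 * C) ^ p : ℝ) ≠ 0 by positivity)).1 hs

theorem mainTheorem8 (p : ℝ) (hp : 2 ≤ p)
    (φ : ℝ → ℝ) (hφ : ∀ t ∈ Ioc (0 : ℝ) 1, 0 < φ t)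
    (ν : Measure UnitAddCircle) [IsFiniteMeasure ν]
    (hsing : ν ⟂ₘ (volume : Measure UnitAddCircle))
    (hsmooth : IsSmoothMeasure φ ν)
    (hint : ∫⁻ t in Ioc (0 : ℝ) 1, ENNReal.ofReal (φ t ^ p / t) < ∞) :
    Summable (fun n : ℤ => ‖measureFourierCoeff ν n‖ ^ p) := by
  obtain ⟨C, hC, hle⟩ := hsmooth
  have hb := summable_dyadic_of_lintegral (by linarith) (modulusOfSmoothness_mono ν)
    (modulusOfSmoothness_nonneg ν) hC hle hint
  -- The shift by one gives `h = 2^{-(k+2)}`, so that `2^k ≤ |n| < 2^{k+1}` becomes `1/4 ≤ |n|h <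
  -- 1/2`.
  have hb' := ((summable_nat_add_iff 1).2 hb).mul_left ((Real.pi / 2) ^ p)
  refine summable_int_of_dyadic (fun n => by positivity) hb' fun k s hs => ?_
  set h : ℝ := (1 / 2) ^ (k + 1 + 1) with hh
  have hpos : 0 < h := by positivity
  have hmul : (2 : ℝ) ^ k * h = 1 / 4 := by
    rw [hh, pow_succ, pow_succ, ← mul_assoc, ← mul_assoc, ← mul_pow]
    norm_num
  have hω := modulusOfSmoothness_nonneg ν h
  rw [← Real.mul_rpow (by positivity) (by positivity)]
  refine sum_rpow_le_of_sum_sq_le s (fun _ => norm_nonneg _) (by positivity) hp ?_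
  refine sum_norm_measureFourierCoeff_sq_le ν hpos ?_ s fun n hn => ?_
  · nlinarith [one_le_pow₀ (show (1 : ℝ) ≤ 2 by norm_num) (n := k)]
  · obtain ⟨hn0, hlog⟩ := hs n hn
    have h1 : 2 ^ k ≤ n.natAbs := hlog ▸ Nat.pow_log_le_self 2 (Int.natAbs_ne_zero.2 hn0)
    have h2 : n.natAbs < 2 ^ (k + 1) := hlog ▸ Nat.lt_pow_succ_log_self (by norm_num) _
    have habs : |(n : ℝ)| = (n.natAbs : ℝ) := by
      rw [Nat.cast_natAbs, Int.cast_abs]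
    have h1' : (2 : ℝ) ^ k ≤ |(n : ℝ)| := by rw [habs]; exact_mod_cast h1
    have h2' : |(n : ℝ)| ≤ 2 * (2 : ℝ) ^ k := by
      rw [habs, mul_comm, ← pow_succ]; exact_mod_cast h2.le
    constructor <;> nlinarith
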